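/- **Theorem.** Let $J\ge 0$, let $\Omega_1,\dots,\Omega_J\subseteq[-\tfrac12,\tfrac12)^2$ be pairwise disjoint open sets, let $\boldsymbol\alpha_j=(\alpha_{j1},\alpha_{j2})\in\mathbb C^2$ and $\beta_j\in\mathbb C$, and let $$u(\boldsymbol x)=\sum_{j=1}^J(\boldsymbol\alpha_j^T\boldsymbol x+\beta_j)\,1_{\Omega_j}(\boldsymbol x),\qquad \boldsymbol x\in\mathbb R^2 .$$ Let $\mathbb K\subset\mathbb Z^2$ be a finite set and let $\boldsymbol a(\boldsymbol k)\in\mathbb C$ for $\boldsymbol k\in\mathbb K$, and suppose that $\Gamma=\bigcup_{j=1}^J\partial\Omega_j$ is contained in the zero set of the trigonometric polynomial $\varphi(\boldsymbol x)=\sum_{\boldsymbol k\in\mathbb K}\boldsymbol a(\boldsymbol k)e^{-2\pi i\boldsymbol k\cdot\boldsymbol x}$. Then there is an integrable vector field $p=(p_1,p_2):\mathbb R^2\to\mathbb C^2$, namely the piecewise constant field $p=\sum_{j=1}^J\boldsymbol\alpha_j1_{\Omega_j}$, with the following property. Take derivatives in the sense of tempered distributions, let $\nabla_s p=\tfrac12(\nabla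 p+\nabla p^T)$ be the symmetric gradient, and let $\mathscr F$ be the Fourier transform with kernel $e^{-2\pi i\boldsymbol\xi\cdot\boldsymbol x}$, applied to each component. Then the Fourier transform of every component of $\nabla u-p$ and of $\nabla_s p$ is a continuous function on $\mathbb R^2$, and for every $\boldsymbol\xi\in\mathbb R^2$ $$\sum_{\boldsymbol k\in\mathbb K}\mathscr F(\nabla u-p)(\boldsymbol\xi+\boldsymbol k)\,\boldsymbol a(\boldsymbol k)=0,\qquad \sum_{\boldsymbol k\in\mathbb K}\mathscr F(\nabla_s p)(\boldsymbol\xi+\boldsymbol k)\,\boldsymbol a(\boldsymbol k)=0 .$$ -/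

import Mathlib

open MeasureTheory
open scoped SchwartzMap FourierTransform LineDeriv

noncomputable section

/-- The Euclidean plane. -/
abbrev Plane : Type := EuclideanSpace ℝ (Fin 2)

/-- The half-open unit square centred at the origin. -/
def unitSquare : Set Plane := {x | ∀ i, -(1 / 2 : ℝ) ≤ x i ∧ x i < 1 / 2}

/-- The data of a piecewise linear function on the plane with `J` pieces: complex slopes and
intercepts, and pairwise disjoint open regions inside the unit square. -/
structure PiecewiseLinear (J : ℕ) where
  /-- slopes -/
  α : Fin J → Fin 2 → ℂ
  /-- intercepts -/
  β : Fin J → ℂ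
  /-- regions -/
  Ω : Fin J → Set Plane
  isOpen_Ω : ∀ j, IsOpen (Ω j)
  Ω_subset : ∀ j, Ω j ⊆ unitSquare
  disjoint_Ω : Pairwise fun j l => Disjoint (Ω j) (Ω l)

namespace PiecewiseLinear

variable {J : ℕ}

/-- The function `u(x) = ∑ j, (α_j ⬝ x + β_j) 1_{Ω_j}(x)`. -/
def toFun (S : PiecewiseLinear J) (x : Plane) : ℂ :=
  ∑ j, (S.Ω j).indicator (fun y : Plane => (∑ i, S.α j i * (y i : ℂ)) + S.β j) x

/-- The piecewise constant vector field `∑ j, α_j 1_{Ω_j}(x)`. -/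
def slopeField (S : PiecewiseLinear J) (x : Plane) : Fin 2 → ℂ :=
  ∑ j, (S.Ω j).indicator (fun _ => S.α j) x

/-- The singularity set `Γ = ⋃ j, ∂Ω_j`. -/
def singularitySet (S : PiecewiseLinear J) : Set Plane := ⋃ j, frontier (S.Ω j)

end PiecewiseLinear

theorem unitSquare_subset_closedBall : unitSquare ⊆ Metric.closedBall (0 : Plane) 1 := by
  intro x hx
  rw [mem_closedBall_zero_iff, EuclideanSpace.norm_eq, Fin.sum_univ_two]
  apply Real.sqrt_le_iff.mpr
  have h0 := hx 0
  have h1 := hx 1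
  refine ⟨zero_le_one, ?_⟩
  simp only [Real.norm_eq_abs, sq_abs]
  nlinarith

namespace PiecewiseLinear

variable {J : ℕ}

theorem memLp_toFun (S : PiecewiseLinear J) : MemLp S.toFun 1 volume := by
  have h : ∀ j ∈ Finset.univ, MemLp ((S.Ω j).indicator
      (fun y : Plane => (∑ i, S.α j i * (y i : ℂ)) + S.β j)) 1 volume := by
    intro j _
    rw [memLp_one_iff_integrable, integrable_indicator_iff (S.isOpen_Ω j).measurableSet]
    have hc : Continuous (fun y : Plane => (∑ i, S.α j i * (y i : ℂ)) + S.β j) := by fun_prop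
    exact (hc.continuousOn.integrableOn_compact
      (isCompact_closedBall (0 : Plane) 1)).mono_set
      ((S.Ω_subset j).trans unitSquare_subset_closedBall)
  exact memLp_finsetSum Finset.univ h

end PiecewiseLinear

/-- The tempered distribution `ψ ↦ ∫ ψ f` given by an integrable function `f`. -/
def distributionOf (f : Plane → ℂ) (hf : MemLp f 1 volume) : 𝓢'(Plane, ℂ) :=
  Lp.toTemperedDistribution (hf.toLp f)

/-- The distributional partial derivative with respect to the `i`-th coordinate. -/
def partialDeriv (i : Fin 2) (T : 𝓢'(Plane, ℂ)) : 𝓢'(Plane, ℂ) :=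
  ∂_{(EuclideanSpace.single i (1 : ℝ) : Plane)} T

/-- The distributional gradient. -/
def grad (T : 𝓢'(Plane, ℂ)) (i : Fin 2) : 𝓢'(Plane, ℂ) := partialDeriv i T

/-- The symmetric gradient `(∇p + ∇pᵀ) / 2` of a distributional vector field. -/
def symGrad (P : Fin 2 → 𝓢'(Plane, ℂ)) : Matrix (Fin 2) (Fin 2) 𝓢'(Plane, ℂ) :=
  Matrix.of fun i j => (1 / 2 : ℂ) • (partialDeriv j (P i) + partialDeriv i (P j))

/-- An integer frequency, as a vector of the plane. -/
def freq (k : Fin 2 → ℤ) : Plane := WithLp.toLp 2 fun i => (k i : ℝ)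

/-- The trigonometric polynomial `∑ k ∈ K, a(k) e^{-2πi k ⬝ x}`. -/
def trigPoly (K : Finset (Fin 2 → ℤ)) (a : (Fin 2 → ℤ) → ℂ) (x : Plane) : ℂ :=
  ∑ k ∈ K, a k * Complex.exp (-2 * Real.pi * Complex.I * ∑ i, (k i : ℂ) * (x i : ℂ))

/-- The Fourier transform of the tempered distribution `T` is the continuous function `F`
(which is determined by `T`). This gives a meaning to the values of `𝓕 T` at points. -/
def HasFourierFunction (T : 𝓢'(Plane, ℂ)) (F : Plane → ℂ) : Prop :=
  Continuous F ∧
    ∀ ψ : 𝓢(Plane, ℂ), Integrable (fun ξ => ψ ξ * F ξ) ∧ (𝓕 T) ψ = ∫ ξ, ψ ξ * F ξ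

/-- The Fourier transform of `T` is a continuous function, and
`∑ k ∈ K, (𝓕 T)(ξ + k) a(k) = 0` at every point `ξ`. -/
def FourierAnnihilated (K : Finset (Fin 2 → ℤ)) (a : (Fin 2 → ℤ) → ℂ) (T : 𝓢'(Plane, ℂ)) :
    Prop :=
  ∃ F : Plane → ℂ, HasFourierFunction T F ∧ ∀ ξ : Plane, ∑ k ∈ K, F (ξ + freq k) * a k = 0

end

/-! On each region, `𝓕(∂ᵢu - pᵢ)(ξ)` is minus the integral of `∂ᵢ(e_ξ f)`, where `e_ξ` is the plane
wave and `f` the affine piece. Summing over the shifts `ξ + k` with weights `a k` replaces `e_ξ` by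
`φ e_ξ`, with `φ` the trigonometric polynomial. What remains is the integral of `∂ᵢ(φ e_ξ f)` over
an open set on whose boundary `φ` vanishes, so it should be zero by the divergence theorem. The
boundary may be arbitrarily rough, so this is proved by hand in
`setIntegral_partialDeriv_eq_zero_of_frontier`: Fubini reduces it to slices, which are bounded open
subsets of the line. There the function cut off outside the slice is continuous, and it is
differentiable except at simple zeros, of which there are countably many; the fundamental theorem of
calculus tolerates such a set. The symmetric gradient is the same argument with constant pieces,
`fourierAnnihilated_partialDeriv_sub` covering both cases. -/

noncomputable section

/-! ### Integration over open sets with rough boundary -/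

/-- The zeros of a function on the line at which its derivative does not vanish are isolated, hence
countable. -/
theorem countable_setOf_eq_zero_deriv_ne_zero {E : Type*} [NormedAddCommGroup E] [NormedSpace ℝ E]
    {f f' : ℝ → E} (hf : ∀ x, HasDerivAt f (f' x) x) : {x | f x = 0 ∧ f' x ≠ 0}.Countable := by
  refine (HereditarilyLindelofSpace.isLindelof _).countable_of_isDiscrete ?_
  rw [isDiscrete_iff_nhdsNE]
  intro x hx
  rw [← disjoint_iff, Filter.disjoint_principal_right]
  filter_upwards [(hf x).eventually_ne (c := 0) hx.2] with z hz hz'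
  exact hz hz'.1

/-- A differentiable function that vanishes on the frontier of an open set `U` can be cut off
outside `U`; the result is differentiable wherever a frontier point is not a simple zero. -/
theorem hasDerivAt_indicator_of_frontier {E : Type*} [NormedAddCommGroup E] [NormedSpace ℝ E]
    {U : Set ℝ} (hU : IsOpen U) {f : ℝ → E} {f' : E} {x : ℝ}
    (hf : HasDerivAt f f' x) (h0 : x ∈ frontier U → f x = 0 ∧ f' = 0) :
    HasDerivAt (U.indicator f) (U.indicator (fun _ => f') x) x := by
  by_cases hx : x ∈ U
  · rw [Set.indicator_of_mem hx]
    refine hf.congr_of_eventuallyEq ?_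
    filter_upwards [hU.mem_nhds hx] with y hy
    exact Set.indicator_of_mem hy f
  · rw [Set.indicator_of_notMem hx]
    by_cases hc : x ∈ closure U
    · obtain ⟨h1, rfl⟩ := h0 (by rw [hU.frontier_eq]; exact ⟨hc, hx⟩)
      -- Here `f y = o(y - x)`, and cutting off only decreases the norm.
      rw [hasDerivAt_iff_isLittleO] at hf ⊢
      simp only [h1, Set.indicator_of_notMem hx, smul_zero, sub_zero] at hf ⊢
      refine (Asymptotics.isBigO_of_le _ fun y => ?_).trans_isLittleO hf
      exact norm_indicator_le_norm_self f y
    · refine (hasDerivAt_const x (0 : E)).congr_of_eventuallyEq ?_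
      filter_upwards [isClosed_closure.isOpen_compl.mem_nhds hc] with y hy
      exact Set.indicator_of_notMem (fun h => hy (subset_closure h)) f

/-- The derivative of a `C¹` function vanishing on the frontier of a bounded open subset of the line
has integral zero over this set. -/
theorem setIntegral_deriv_eq_zero_of_frontier {E : Type*} [NormedAddCommGroup E] [NormedSpace ℝ E]
    [CompleteSpace E] {U : Set ℝ} (hU : IsOpen U) {R : ℝ} (hUR : ∀ x ∈ U, |x| ≤ R)
    {f f' : ℝ → E} (hf : ∀ x, HasDerivAt f (f' x) x) (hf' : Continuous f')
    (h0 : ∀ x ∈ frontier U, f x = 0) : ∫ x in U, f' x = 0 := by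
  have hcf : Continuous f := continuous_iff_continuousAt.2 fun x => (hf x).continuousAt
  have hR : ∀ x, R < |x| → x ∉ U := fun x hx h => absurd (hUR x h) (not_le.2 hx)
  -- The absolute value covers a negative `R` (empty `U`); the added 1 puts both endpoints outside
  -- `U`.
  have hsupp : Function.support (U.indicator f') ⊆ Set.Ioc (-(|R| + 1)) (|R| + 1) := by
    intro x hx
    have hxU := hUR x (Set.support_indicator_subset hx)
    have := abs_le.1 (hxU.trans (le_abs_self R))
    exact ⟨by linarith [this.1], by linarith [this.2]⟩
  have hle : -(|R| + 1) ≤ |R| + 1 := by linarith [abs_nonneg R]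
  have hint : Integrable (U.indicator f') := by
    rw [integrable_indicator_iff hU.measurableSet]
    exact (hf'.continuousOn.integrableOn_compact
      (isCompact_Icc (a := -R) (b := R))).mono_set fun x hx => abs_le.1 (hUR x hx)
  -- The exceptional set consists of all simple zeros of `f`, whether or not they lie on the
  -- frontier.
  rw [← integral_indicator hU.measurableSet,
    ← intervalIntegral.integral_eq_integral_of_support_subset hsupp,
    integral_eq_of_hasDerivAt_off_countable_of_le (U.indicator f) (U.indicator f') hle
      (countable_setOf_eq_zero_deriv_ne_zero hf)
      (continuous_indicator h0 hcf.continuousOn).continuousOn ?_ hint.intervalIntegrable]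
  · have h1 : R < |(|R| + 1)| := by
      rw [abs_of_nonneg (by positivity)]; linarith [le_abs_self R]
    rw [Set.indicator_of_notMem (hR _ h1), Set.indicator_of_notMem (hR _ (by rwa [abs_neg])),
      sub_zero]
  · rintro x ⟨-, hx⟩
    have := hasDerivAt_indicator_of_frontier hU (hf x) fun hxf =>
      ⟨h0 x hxf, by_contra fun h => hx ⟨h0 x hxf, h⟩⟩
    exact this

/-- The partial derivative of a `C¹` function vanishing on the frontier of a bounded open set
has integral zero over this set. -/
theorem setIntegral_partialDeriv_eq_zero_of_frontier {n : ℕ} {E : Type*} [NormedAddCommGroup E]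
    [NormedSpace ℝ E] [CompleteSpace E] {Ω : Set (EuclideanSpace ℝ (Fin (n + 1)))}
    (hΩ : IsOpen Ω) (hb : Bornology.IsBounded Ω) (i : Fin (n + 1))
    {h h' : EuclideanSpace ℝ (Fin (n + 1)) → E}
    (hh : ∀ x, HasLineDerivAt ℝ h (h' x) x (EuclideanSpace.single i 1)) (hh' : Continuous h')
    (h0 : ∀ x ∈ frontier Ω, h x = 0) : ∫ x in Ω, h' x = 0 := by
  obtain ⟨R, hR⟩ := hb.subset_closedBall 0
  have hint : Integrable (Ω.indicator h') := by
    rw [integrable_indicator_iff hΩ.measurableSet]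
    exact (hh'.continuousOn.integrableOn_compact (isCompact_closedBall 0 R)).mono_set hR
  -- Splits off the `i`-th coordinate, so that Fubini integrates first along lines in direction `i`.
  let e := (MeasurableEquiv.toLp 2 (Fin (n + 1) → ℝ)).symm.trans
    (MeasurableEquiv.piFinSuccAbove (fun _ => ℝ) i)
  have he : MeasurePreserving e.symm :=
    ((EuclideanSpace.volume_preserving_symm_measurableEquiv_toLp _).trans
      (volume_preserving_piFinSuccAbove (fun _ => ℝ) i)).symm e
  have hec : ∀ t y, e.symm (t, y) = WithLp.toLp 2 (i.insertNth t y) := fun _ _ => rfl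
  rw [← integral_indicator hΩ.measurableSet, ← he.integral_comp e.symm.measurableEmbedding,
    Measure.volume_eq_prod, integral_prod_symm]
  swap
  · rw [← Measure.volume_eq_prod]
    exact (he.integrable_comp_emb e.symm.measurableEmbedding).2 hint
  refine integral_eq_zero_of_ae (Filter.Eventually.of_forall fun y => ?_)
  let c : ℝ → EuclideanSpace ℝ (Fin (n + 1)) := fun t => WithLp.toLp 2 (i.insertNth t y)
  have hc : Continuous c := by
    refine (PiLp.continuous_toLp 2 _).comp ?_
    exact Continuous.finInsertNth i continuous_id continuous_const
  have hadd : ∀ t s, c t + s • EuclideanSpace.single i (1 : ℝ) = c (t + s) := by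
    intro t s
    ext j
    refine Fin.succAboveCases i ?_ (fun k => ?_) j <;> simp [c]
  have hderiv : ∀ t, HasDerivAt (h ∘ c) (h' (c t)) t := by
    intro t
    have h1 : HasDerivAt (fun s => h (c t + s • EuclideanSpace.single i (1 : ℝ))) (h' (c t))
      (t - t) := by rw [sub_self]; exact hh (c t)
    have h2 := h1.comp_sub_const t t
    simp only [hadd, add_sub_cancel] at h2
    exact h2
  -- The frontier of a slice lies in the slice of the frontier, so the vanishing passes to every
  -- line.
  have key := setIntegral_deriv_eq_zero_of_frontier (hΩ.preimage hc) (R := R) (fun t ht => by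
      have h1 : ‖c t i‖ ≤ ‖c t‖ := PiLp.norm_apply_le (c t) i
      have h2 : c t i = t := by simp [c]
      rw [h2] at h1
      exact h1.trans (mem_closedBall_zero_iff.1 (hR ht)))
    hderiv (hh'.comp hc) (fun t ht => h0 _ (hc.frontier_preimage_subset Ω ht))
  rw [← integral_indicator (hΩ.preimage hc).measurableSet] at key
  exact key

/-! ### Fourier transforms of integrable functions and of their distributional derivatives -/

theorem distributionOf_apply {f : Plane → ℂ} (hf : MemLp f 1 volume) (ψ : 𝓢(Plane, ℂ)) :
    distributionOf f hf ψ = ∫ x, ψ x * f x := by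
  rw [distributionOf, Lp.toTemperedDistribution_apply]
  refine integral_congr_ae ?_
  filter_upwards [hf.coeFn_toLp] with x hx
  rw [hx, smul_eq_mul]

theorem continuous_fourier_of_integrable {f : Plane → ℂ} (hf : Integrable f) :
    Continuous (𝓕 f) :=
  VectorFourier.fourierIntegral_continuous Real.continuous_fourierChar
    (L := innerₗ Plane) continuous_inner hf

theorem norm_fourier_le_integral_norm (f : Plane → ℂ) (ξ : Plane) : ‖𝓕 f ξ‖ ≤ ∫ x, ‖f x‖ :=
  VectorFourier.norm_fourierIntegral_le_integral_norm _ _ _ _ _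

theorem integrable_mul_fourier {f : Plane → ℂ} (hf : Integrable f) (ψ : 𝓢(Plane, ℂ)) :
    Integrable fun ξ => ψ ξ * 𝓕 f ξ :=
  ψ.integrable.mul_bdd (continuous_fourier_of_integrable hf).aestronglyMeasurable
    (Filter.Eventually.of_forall (norm_fourier_le_integral_norm f))

namespace HasFourierFunction

variable {T T' : 𝓢'(Plane, ℂ)} {F F' : Plane → ℂ}

theorem add (h : HasFourierFunction T F) (h' : HasFourierFunction T' F') :
    HasFourierFunction (T + T') (fun ξ => F ξ + F' ξ) := by
  refine ⟨h.1.add h'.1, fun ψ => ?_⟩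
  obtain ⟨h1, h2⟩ := h.2 ψ
  obtain ⟨h1', h2'⟩ := h'.2 ψ
  simp only [mul_add]
  refine ⟨h1.add h1', ?_⟩
  rw [integral_add h1 h1', ← h2, ← h2']
  simp [TemperedDistribution.fourier_apply]

theorem const_smul (c : ℂ) (h : HasFourierFunction T F) :
    HasFourierFunction (c • T) (fun ξ => c * F ξ) := by
  refine ⟨h.1.const_mul c, fun ψ => ?_⟩
  obtain ⟨h1, h2⟩ := h.2 ψ
  simp only [mul_left_comm _ c]
  refine ⟨h1.const_mul c, ?_⟩
  rw [integral_const_mul, ← h2]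
  simp [TemperedDistribution.fourier_apply]

theorem sub (h : HasFourierFunction T F) (h' : HasFourierFunction T' F') :
    HasFourierFunction (T - T') (fun ξ => F ξ - F' ξ) := by
  have hT : T - T' = T + (-1 : ℂ) • T' := by
    ext ψ
    simp [sub_eq_add_neg]
  simpa only [hT, neg_one_mul, ← sub_eq_add_neg] using h.add (h'.const_smul (-1))

theorem of_memLp {f : Plane → ℂ} (hf : MemLp f 1 volume) :
    HasFourierFunction (distributionOf f hf) (𝓕 f) := by
  have hi : Integrable f := memLp_one_iff_integrable.1 hf
  refine ⟨continuous_fourier_of_integrable hi, fun ψ => ⟨integrable_mul_fourier hi ψ, ?_⟩⟩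
  rw [TemperedDistribution.fourier_apply, distributionOf_apply]
  simp only [SchwartzMap.fourier_coe]
  -- The multiplication formula `∫ 𝓕ψ · f = ∫ ψ · 𝓕f`.
  simpa only [flip_innerₗ] using! VectorFourier.integral_fourierIntegral_smul_eq_flip
    (L := innerₗ Plane) Real.continuous_fourierChar continuous_inner (ψ.integrable (μ := volume)) hi

theorem partialDeriv (i : Fin 2) (h : HasFourierFunction T F) :
    HasFourierFunction (partialDeriv i T) (fun ξ => 2 * Real.pi * Complex.I * (ξ i : ℂ) * F ξ) := by
  have hF := h.1
  refine ⟨by fun_prop, fun ψ => ?_⟩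
  have hg : (fun ξ : Plane => ((inner ℝ ξ (EuclideanSpace.single i (1 : ℝ)) : ℝ) :
      ℂ)).HasTemperateGrowth := by
    fun_prop
  -- The factor `ξ i` is moved onto the test function, which stays Schwartz; this also gives
  -- integrability.
  obtain ⟨h1, h2⟩ := h.2 (SchwartzMap.smulLeftCLM ℂ
    (fun ξ : Plane => ((inner ℝ ξ (EuclideanSpace.single i (1 : ℝ)) : ℝ) : ℂ)) ψ)
  have hfun : ∀ ξ, ψ ξ * (2 * Real.pi * Complex.I * (ξ i : ℂ) * F ξ) =
      2 * Real.pi * Complex.I * (SchwartzMap.smulLeftCLM ℂ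
    (fun ξ : Plane => ((inner ℝ ξ (EuclideanSpace.single i (1 : ℝ)) : ℝ) : ℂ)) ψ ξ * F ξ) := by
    intro ξ
    rw [SchwartzMap.smulLeftCLM_apply_apply hg]
    simp only [EuclideanSpace.inner_single_right, smul_eq_mul]
    simp
    ring
  simp only [hfun]
  refine ⟨h1.const_mul _, ?_⟩
  rw [integral_const_mul, ← h2, _root_.partialDeriv, TemperedDistribution.fourier_lineDerivOp_eq]
  simp

end HasFourierFunction

theorem freq_apply (k : Fin 2 → ℤ) (i : Fin 2) : freq k i = k i := rfl

theorem FourierAnnihilated.add {K : Finset (Fin 2 → ℤ)} {a : (Fin 2 → ℤ) → ℂ}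
    {T T' : 𝓢'(Plane, ℂ)} (h : FourierAnnihilated K a T) (h' : FourierAnnihilated K a T') :
    FourierAnnihilated K a (T + T') := by
  obtain ⟨F, hF, h0⟩ := h
  obtain ⟨F', hF', h0'⟩ := h'
  refine ⟨_, hF.add hF', fun ξ => ?_⟩
  simp only [add_mul, Finset.sum_add_distrib, h0, h0', add_zero]

theorem FourierAnnihilated.const_smul {K : Finset (Fin 2 → ℤ)} {a : (Fin 2 → ℤ) → ℂ}
    {T : 𝓢'(Plane, ℂ)} (c : ℂ) (h : FourierAnnihilated K a T) :
    FourierAnnihilated K a (c • T) := by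
  obtain ⟨F, hF, h0⟩ := h
  refine ⟨_, hF.const_smul c, fun ξ => ?_⟩
  simp only [mul_assoc, ← Finset.mul_sum, h0, mul_zero]
-- Plane waves and line derivatives
/-- The plane wave `e^{-2πi ξ ⬝ x}`. -/
def planeWave (ξ x : Plane) : ℂ :=
  Complex.exp (-2 * Real.pi * Complex.I * ∑ i, (ξ i : ℂ) * (x i : ℂ))

@[fun_prop]
theorem continuous_planeWave (ξ : Plane) : Continuous (planeWave ξ) := by
  unfold planeWave
  fun_prop

theorem planeWave_add_freq (ξ x : Plane) (k : Fin 2 → ℤ) :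
    planeWave (ξ + freq k) x =
      Complex.exp (-2 * Real.pi * Complex.I * ∑ i, (k i : ℂ) * (x i : ℂ)) * planeWave ξ x := by
  rw [planeWave, planeWave, ← Complex.exp_add]
  congr 1
  simp only [PiLp.add_apply, freq_apply, Fin.sum_univ_two]
  push_cast
  ring

/-- Turns the weighted sum over frequency shifts into multiplication in `x`, where the zeros of the
polynomial can be used. -/
theorem sum_mul_planeWave (K : Finset (Fin 2 → ℤ)) (a : (Fin 2 → ℤ) → ℂ) (ξ x : Plane) :
    ∑ k ∈ K, a k * planeWave (ξ + freq k) x = trigPoly K a x * planeWave ξ x := by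
  simp only [trigPoly, Finset.sum_mul, planeWave_add_freq, mul_assoc]

theorem fourier_eq_integral_planeWave_mul (f : Plane → ℂ) (ξ : Plane) :
    𝓕 f ξ = ∫ x, planeWave ξ x * f x := by
  rw [Real.fourier_eq']
  congr 1
  ext x
  rw [smul_eq_mul, planeWave]
  congr 2
  simp only [PiLp.inner_apply, Fin.sum_univ_two]
  simp
  ring

theorem hasLineDerivAt_planeWave (ξ x : Plane) (i : Fin 2) :
    HasLineDerivAt ℝ (planeWave ξ) (-2 * Real.pi * Complex.I * ξ i * planeWave ξ x) x
      (EuclideanSpace.single i 1) := by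
  have h : ∀ t : ℝ, planeWave ξ (x + t • EuclideanSpace.single i (1 : ℝ)) =
      Complex.exp (-2 * Real.pi * Complex.I * ξ i * t) * planeWave ξ x := by
    intro t
    rw [planeWave, planeWave, ← Complex.exp_add]
    congr 1
    fin_cases i <;> simp [Fin.sum_univ_two] <;> ring
  unfold HasLineDerivAt
  simp only [h]
  have h1 : HasDerivAt (fun t : ℝ => -2 * Real.pi * Complex.I * ξ i * (t : ℂ))
      (-2 * Real.pi * Complex.I * ξ i * 1) 0 := (HasDerivAt.ofReal_comp (hasDerivAt_id 0)).const_mul _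
  simpa using h1.cexp.mul_const (planeWave ξ x)

theorem hasLineDerivAt_affine (α : Fin 2 → ℂ) (β : ℂ) (x : Plane) (i : Fin 2) :
    HasLineDerivAt ℝ (fun y : Plane => (∑ l, α l * (y l : ℂ)) + β) (α i) x
      (EuclideanSpace.single i 1) := by
  have h : ∀ t : ℝ, (∑ l, α l * (((x + t • EuclideanSpace.single i (1 : ℝ)) l : ℝ) : ℂ)) + β =
      α i * (t : ℂ) + ((∑ l, α l * (x l : ℂ)) + β) := by
    intro t
    fin_cases i <;> simp [Fin.sum_univ_two] <;> ring
  unfold HasLineDerivAt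
  simp only [h]
  have h1 : HasDerivAt (fun t : ℝ => α i * (t : ℂ)) (α i * 1) 0 :=
    (HasDerivAt.ofReal_comp (hasDerivAt_id 0)).const_mul _
  simpa using h1.add_const ((∑ l, α l * (x l : ℂ)) + β)

/-! ### Annihilation for piecewise smooth functions -/

namespace PiecewiseLinear

variable {J : ℕ} (S : PiecewiseLinear J)

theorem isBounded_Ω (j : Fin J) : Bornology.IsBounded (S.Ω j) :=
  Metric.isBounded_closedBall.subset ((S.Ω_subset j).trans unitSquare_subset_closedBall)

theorem integrableOn_Ω (j : Fin J) {f : Plane → ℂ} (hf : Continuous f) :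
    IntegrableOn f (S.Ω j) :=
  (hf.continuousOn.integrableOn_compact (isCompact_closedBall (0 : Plane) 1)).mono_set
    ((S.Ω_subset j).trans unitSquare_subset_closedBall)

theorem integrable_sum_indicator {f : Fin J → Plane → ℂ} (hf : ∀ j, Continuous (f j)) :
    Integrable fun x => ∑ j, (S.Ω j).indicator (f j) x :=
  integrable_finsetSum _ fun j _ =>
    (integrable_indicator_iff (S.isOpen_Ω j).measurableSet).2 (S.integrableOn_Ω j (hf j))

theorem fourier_sum_indicator {f : Fin J → Plane → ℂ} (hf : ∀ j, Continuous (f j)) (ξ : Plane) :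
    𝓕 (fun x => ∑ j, (S.Ω j).indicator (f j) x) ξ = ∑ j, ∫ x in S.Ω j, planeWave ξ x * f j x := by
  rw [fourier_eq_integral_planeWave_mul]
  simp only [Finset.mul_sum, ← Set.indicator_mul_right]
  rw [integral_finsetSum]
  · exact Finset.sum_congr rfl fun j _ => integral_indicator (S.isOpen_Ω j).measurableSet
  · exact fun j _ => (integrable_indicator_iff (S.isOpen_Ω j).measurableSet).2
      (S.integrableOn_Ω j ((continuous_planeWave ξ).mul (hf j)))

/-- The partial derivative of a piecewise smooth function has an absolutely continuous part and a
part carried by the singularity set; the Fourier transform of the latter is annihilated by a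
trigonometric polynomial that vanishes on the singularity set. -/
theorem fourierAnnihilated_partialDeriv_sub {K : Finset (Fin 2 → ℤ)} {a : (Fin 2 → ℤ) → ℂ}
    (hΓ : S.singularitySet ⊆ {x : Plane | trigPoly K a x = 0}) (i : Fin 2)
    {f f' : Fin J → Plane → ℂ}
    (hd : ∀ j x, HasLineDerivAt ℝ (f j) (f' j x) x (EuclideanSpace.single i 1))
    (hf : ∀ j, Continuous (f j)) (hf' : ∀ j, Continuous (f' j))
    {g q : Plane → ℂ} (hg : MemLp g 1 volume) (hq : MemLp q 1 volume)
    (hgf : g = fun x => ∑ j, (S.Ω j).indicator (f j) x)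
    (hqf : q = fun x => ∑ j, (S.Ω j).indicator (f' j) x) :
    FourierAnnihilated K a (partialDeriv i (distributionOf g hg) - distributionOf q hq) := by
  refine ⟨_, ((HasFourierFunction.of_memLp hg).partialDeriv i).sub
    (HasFourierFunction.of_memLp hq), fun ξ => ?_⟩
  simp only [hgf, hqf, S.fourier_sum_indicator hf, S.fourier_sum_indicator hf', Finset.mul_sum,
    ← Finset.sum_sub_distrib, Finset.sum_mul]
  -- With the sum over regions outside, each region contributes zero on its own.
  rw [Finset.sum_comm]
  refine Finset.sum_eq_zero fun j _ => ?_
  -- The `i`-th derivative of `φ e_ξ f_j`, expanded over `k` by the product rule.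
  let h' : Plane → ℂ := fun x => ∑ k ∈ K, a k *
    (-2 * Real.pi * Complex.I * ((ξ + freq k) i : ℝ) * planeWave (ξ + freq k) x * f j x +
      planeWave (ξ + freq k) x * f' j x)
  have hderiv : ∀ x, HasLineDerivAt ℝ (fun y => ∑ k ∈ K, a k * (planeWave (ξ + freq k) y * f j y))
      (h' x) x (EuclideanSpace.single i 1) := by
    intro x
    refine HasDerivAt.fun_sum fun k _ => HasDerivAt.const_mul (a k) ?_
    have := HasDerivAt.mul (hasLineDerivAt_planeWave (ξ + freq k) x i) (hd j x)
    simpa only [zero_smul, add_zero] using! this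
  have hcont : Continuous h' := by fun_prop
  have key := setIntegral_partialDeriv_eq_zero_of_frontier (S.isOpen_Ω j) (S.isBounded_Ω j) i
    hderiv hcont fun x hx => by
      simp only [← mul_assoc, ← Finset.sum_mul, sum_mul_planeWave]
      rw [show trigPoly K a x = 0 from hΓ (Set.mem_iUnion.2 ⟨j, hx⟩), zero_mul, zero_mul]
  have hi1 : ∀ k, IntegrableOn (fun x => planeWave (ξ + freq k) x * f j x) (S.Ω j) := fun k =>
    S.integrableOn_Ω j ((continuous_planeWave _).mul (hf j))
  have hi2 : ∀ k, IntegrableOn (fun x => planeWave (ξ + freq k) x * f' j x) (S.Ω j) := fun k =>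
    S.integrableOn_Ω j ((continuous_planeWave _).mul (hf' j))
  have hi : ∀ k, IntegrableOn (fun x => a k *
      (-2 * Real.pi * Complex.I * ((ξ + freq k) i : ℝ) * (planeWave (ξ + freq k) x * f j x) +
        planeWave (ξ + freq k) x * f' j x)) (S.Ω j) :=
    fun k => (((hi1 k).const_mul _).add (hi2 k)).const_mul _
  simp only [h', mul_assoc (_ * _) (planeWave _ _)] at key
  -- The sign arises because `∂ᵢ` has symbol `2πi ξᵢ`, whereas differentiating the plane wave gives
  -- `-2πi ξᵢ`.
  rw [← neg_eq_zero, ← Finset.sum_neg_distrib, ← key]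
  refine Eq.trans ?_ (integral_finsetSum K fun k _ => hi k).symm
  refine Finset.sum_congr rfl fun k _ => ?_
  rw [integral_const_mul, integral_add ((hi1 k).const_mul _) (hi2 k), integral_const_mul]
  ring

theorem slopeField_apply (x : Plane) (i : Fin 2) :
    S.slopeField x i = ∑ j, (S.Ω j).indicator (fun _ => S.α j i) x := by
  rw [slopeField, Finset.sum_apply]
  refine Finset.sum_congr rfl fun j _ => ?_
  by_cases hx : x ∈ S.Ω j <;> simp [hx]

theorem memLp_slopeField (i : Fin 2) : MemLp (fun x => S.slopeField x i) 1 volume := by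
  simp only [slopeField_apply]
  exact memLp_one_iff_integrable.2 (S.integrable_sum_indicator fun _ => continuous_const)

theorem fourierAnnihilated_partialDeriv_slopeField {K : Finset (Fin 2 → ℤ)} {a : (Fin 2 → ℤ) → ℂ}
    (hΓ : S.singularitySet ⊆ {x : Plane | trigPoly K a x = 0}) (i l : Fin 2) :
    FourierAnnihilated K a
      (partialDeriv i (distributionOf (fun x => S.slopeField x l) (S.memLp_slopeField l))) := by
  have h0 : distributionOf (fun _ => 0) MemLp.zero' = 0 := by
    ext ψ
    simp [distributionOf_apply]
  -- The pieces are constant, so the absolutely continuous part to subtract is zero.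
  rw [← sub_zero (partialDeriv _ _), ← h0]
  refine S.fourierAnnihilated_partialDeriv_sub hΓ i (f := fun j _ => S.α j l) (f' := fun _ _ => 0)
    (fun j x => hasDerivAt_const _ _) (fun _ => continuous_const) (fun _ => continuous_const) _ _
    (funext fun x => S.slopeField_apply x l) ?_
  simp

end PiecewiseLinear

end

theorem theorem1 {J : ℕ} (S : PiecewiseLinear J)
    (K : Finset (Fin 2 → ℤ)) (a : (Fin 2 → ℤ) → ℂ)
    (hΓ : S.singularitySet ⊆ {x : Plane | trigPoly K a x = 0}) :
    ∃ (p : Plane → Fin 2 → ℂ) (hp : ∀ i, MemLp (fun x => p x i) 1 volume),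
      p = S.slopeField ∧
      (∀ i, FourierAnnihilated K a
        (grad (distributionOf S.toFun S.memLp_toFun) i - distributionOf (fun x => p x i) (hp i))) ∧
      (∀ i j, FourierAnnihilated K a
        (symGrad (fun l => distributionOf (fun x => p x l) (hp l)) i j)) := by
  refine ⟨S.slopeField, S.memLp_slopeField, rfl, fun i => ?_, fun i j => ?_⟩
  · exact S.fourierAnnihilated_partialDeriv_sub hΓ i
      (f := fun j y => (∑ l, S.α j l * (y l : ℂ)) + S.β j) (f' := fun j _ => S.α j i)
      (fun j x => hasLineDerivAt_affine (S.α j) (S.β j) x i) (fun j => by fun_prop)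
      (fun _ => continuous_const) _ _ rfl (funext fun x => S.slopeField_apply x i)
  · exact ((S.fourierAnnihilated_partialDeriv_slopeField hΓ j i).add
      (S.fourierAnnihilated_partialDeriv_slopeField hΓ i j)).const_smul _
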